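/- Let $n\ge 1$. Let $\mathcal L$ be the set of measurable functions $f:(0,\infty)^n\to\mathbb R$ whose Laplace transform $\widehat f(x)=\int_{(0,\infty)^n} f(s)e^{-s\cdot x}\,ds$ is an absolutely convergent Lebesgue integral for every $x\in(0,\infty)^n$; equality of functions in $\mathcal L$ means equality almost everywhere on $(0,\infty)^n$. For $t\in(0,\infty)^n$ put $(0,t)=(0,t_1)\times\cdots\times(0,t_n)$. For $k,f\in\mathcal L$ let $(k*f)(t)=\int_{(0,t)}k(t-s)f(s)\,ds$, and for $\alpha\in(0,\infty)^n$ let $$I^\alpha f(t)=\frac{1}{\Gamma(\alpha_1)\cdots\Gamma(\alpha_n)}\int_{(0,t)}\prod_{i=1}^n(t_i-s_i)^{\alpha_i-1}f(s)\,ds$$ be the multidimensional Riemann--Liouville integral. Let $K_\alpha\in\mathcal L$ for each $\alpha\in(0,\infty)^n$, and let $J^\alpha f=K_\alpha*f$ for $f\in\mathcal L$; for all $\alpha\in(0,\infty)^n$ and $f\in\mathcal L$ the integral defining $J^\alpha f(t)$ converges absolutely for almost every $t\in(0,\infty)^n$, and $J^\alpha f\in\mathcal L$. Suppose: - Identity: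 there are $n$ linearly independent vectors $\alpha^{(1)},\dots,\alpha^{(n)}\in(0,\infty)^n$ such that, for each $\alpha=\alpha^{(j)}$, $$K_{\alpha}(x)=\frac{x_1^{\alpha_1-1}\cdots x_n^{\alpha_n-1}}{\Gamma(\alpha_1)\cdots\Gamma(\alpha_n)}\quad\text{for almost every }x\in(0,\infty)^n.$$ (For each $\alpha\in(0,\infty)^n$, this equality is equivalent to $J^{\alpha}=I^{\alpha}$ on $\mathcal L$.) - Index law: $J^{\alpha+\beta}=J^\alpha\circ J^\beta$ on $\mathcal L$ for all $\alpha,\beta\in(0,\infty)^n$. - Continuity: for every $x\in(0,\infty)^n$, the map $\alpha\mapsto\widehat{K}_\alpha(x)$ from $(0,\infty)^n$ to $\mathbb R$ is continuous at some point (which may depend on $x$). (For any family $K_\alpha\in\mathcal L$, this is equivalent to: for all $f\in\mathcal L$ and $x\in(0,\infty)^n$, the map $\alpha\mapsto\widehat{J^\alpha f}(x)$ is continuous at some point.) Then, for all $\alpha\in(0,\infty)^n$ and $f\in\mathcal L$, the integral defining $I^\alpha f(t)$ converges absolutely for almost every $t\in(0,\infty)^n$, and $J^\alpha f=I^\alpha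 f$ almost everywhere on $(0,\infty)^n$; that is, $J^\alpha=I^\alpha$ on $\mathcal L$. -/

import Mathlib

open MeasureTheory

namespace MultiRL

/-- The open positive orthant `(0,∞)ⁿ`. -/
def orthant (n : ℕ) : Set (Fin n → ℝ) := {x | ∀ i, 0 < x i}

/-- The open box `(0,t) = (0,t₁) × ⋯ × (0,tₙ)`. -/
def box {n : ℕ} (t : Fin n → ℝ) : Set (Fin n → ℝ) := {s | ∀ i, 0 < s i ∧ s i < t i}

/-- The integrand `f(s) e^{-s·x}` of the Laplace transform. -/
noncomputable def laplaceIntegrand {n : ℕ} (f : (Fin n → ℝ) → ℝ) (x s : Fin n → ℝ) : ℝ :=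
  f s * Real.exp (-∑ i, s i * x i)

/-- The Laplace transform on `(0,∞)ⁿ`. Functions on `(0,∞)ⁿ` are represented by functions on `ℝⁿ`
whose values outside `(0,∞)ⁿ` are never used. -/
noncomputable def laplace {n : ℕ} (f : (Fin n → ℝ) → ℝ) (x : Fin n → ℝ) : ℝ :=
  ∫ s in orthant n, laplaceIntegrand f x s

/-- The class of Laplace transformable functions: the integral defining the Laplace transform
is a (convergent) Lebesgue integral for all `x ∈ (0,∞)ⁿ`. -/
def LaplaceTransformable {n : ℕ} (f : (Fin n → ℝ) → ℝ) : Prop :=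
  ∀ x ∈ orthant n, IntegrableOn (laplaceIntegrand f x) (orthant n)

/-- Equality almost everywhere on `(0,∞)ⁿ`. -/
def AEEq {n : ℕ} (f g : (Fin n → ℝ) → ℝ) : Prop :=
  ∀ᵐ t ∂(volume.restrict (orthant n)), f t = g t

/-- The convolution `(k ∗ f)(t) = ∫_{(0,t)} k(t - s) f(s) ds` of functions on `(0,∞)ⁿ`. -/
noncomputable def conv {n : ℕ} (k f : (Fin n → ℝ) → ℝ) (t : Fin n → ℝ) : ℝ :=
  ∫ s in box t, k (t - s) * f s

/-- The Riemann–Liouville kernel `∏ᵢ xᵢ^{αᵢ - 1} / ∏ᵢ Γ(αᵢ)`. -/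
noncomputable def rlKernel {n : ℕ} (α x : Fin n → ℝ) : ℝ :=
  (∏ i, x i ^ (α i - 1)) / ∏ i, Real.Gamma (α i)

/-- The multidimensional Riemann–Liouville integral of multiorder `α ∈ (0,∞)ⁿ` with left origin `0`:
`I^α f(t) = (∏ᵢ Γ(αᵢ))⁻¹ ∫_{(0,t)} ∏ᵢ (tᵢ - sᵢ)^{αᵢ - 1} f(s) ds`. -/
noncomputable def rlIntegral {n : ℕ} (α : Fin n → ℝ) (f : (Fin n → ℝ) → ℝ) (t : Fin n → ℝ) : ℝ :=
  (∏ i, Real.Gamma (α i))⁻¹ * ∫ s in box t, (∏ i, (t i - s i) ^ (α i - 1)) * f s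

/-- `α ↦ F α`, from `(0,∞)ⁿ` to `ℝ`, is continuous at one point. -/
def ContinuousAtSomePoint {n : ℕ} (F : (Fin n → ℝ) → ℝ) : Prop :=
  ∃ α₀ ∈ orthant n, ContinuousWithinAt F (orthant n) α₀

end MultiRL

namespace MultiRL

variable {n : ℕ}

/-! The Laplace transform turns convolutions into products (`laplace_conv`) and is injective up to
null sets (`LaplaceTransformable.aeEq_of_laplace_eq`), so it is enough to compute the transform of
each `K α` at a fixed `x`. Testing the index law on one function with nonvanishing transform shows
that this number is multiplicative in `α`. The Riemann–Liouville kernel has transform `∏ i, (x i ^ α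
i)⁻¹`, so `φ α = laplace (K α) x * ∏ i, x i ^ α i` is multiplicative on the orthant, continuous at
some point, and 1 at `n` linearly independent vectors.

Such a `φ` is positive, and `log φ` solves Cauchy's equation. It extends to an additive map on `ℝⁿ`,
which is continuous because it is continuous at one point, hence linear; vanishing on a basis, it is
zero. Thus `φ = 1`.

Injectivity holds because the exponentials `e^{-m·s}`, `m ∈ ℕⁿ`, span a point-separating algebra,
which determines finite measures on the orthant. -/

theorem isOpen_orthant (n : ℕ) : IsOpen (orthant n) := by
  have : orthant n = ⋂ i, {x : Fin n → ℝ | 0 < x i} := by ext; simp [orthant]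
  rw [this]
  exact isOpen_iInter_of_finite fun i => isOpen_lt continuous_const (continuous_apply i)

theorem measurableSet_orthant (n : ℕ) : MeasurableSet (orthant n) :=
  (isOpen_orthant n).measurableSet

theorem measurableSet_box (t : Fin n → ℝ) : MeasurableSet (box t) := by
  have : box t = ⋂ i, {s : Fin n → ℝ | 0 < s i ∧ s i < t i} := by ext; simp [box]
  rw [this]
  refine MeasurableSet.iInter fun i => ?_
  exact (measurableSet_lt measurable_const (measurable_pi_apply i)).inter
    (measurableSet_lt (measurable_pi_apply i) measurable_const)

theorem add_mem_orthant {α β : Fin n → ℝ} (hα : α ∈ orthant n) (hβ : β ∈ orthant n) :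
    α + β ∈ orthant n := fun i => add_pos (hα i) (hβ i)

theorem mem_box_iff {s t : Fin n → ℝ} : s ∈ box t ↔ s ∈ orthant n ∧ t - s ∈ orthant n := by
  simp [box, orthant, forall_and]

theorem box_eq_empty {t : Fin n → ℝ} (ht : t ∉ orthant n) : box t = ∅ := by
  ext s
  simp only [Set.mem_empty_iff_false, iff_false, mem_box_iff]
  rintro ⟨h1, h2⟩
  exact ht (by simpa using add_mem_orthant h1 h2)

/-! ### Convolution and the Laplace transform -/

/-- The integrand of the Laplace transform, extended by zero to `ℝⁿ`. -/
noncomputable def weighted (f : (Fin n → ℝ) → ℝ) (x : Fin n → ℝ) : (Fin n → ℝ) → ℝ :=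
  (orthant n).indicator (laplaceIntegrand f x)

theorem integrable_weighted_iff {f : (Fin n → ℝ) → ℝ} {x : Fin n → ℝ} :
    Integrable (weighted f x) ↔ IntegrableOn (laplaceIntegrand f x) (orthant n) :=
  integrable_indicator_iff (measurableSet_orthant n)

theorem LaplaceTransformable.integrable_weighted {f : (Fin n → ℝ) → ℝ}
    (hf : LaplaceTransformable f) {x : Fin n → ℝ} (hx : x ∈ orthant n) :
    Integrable (weighted f x) :=
  integrable_weighted_iff.2 (hf x hx)

theorem integral_weighted (f : (Fin n → ℝ) → ℝ) (x : Fin n → ℝ) :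
    ∫ s, weighted f x s = laplace f x :=
  integral_indicator (measurableSet_orthant n)

theorem weighted_mul_weighted_sub (k f : (Fin n → ℝ) → ℝ) (x t s : Fin n → ℝ) :
    weighted f x s * weighted k x (t - s) =
      Real.exp (-∑ i, t i * x i) * (box t).indicator (fun s => k (t - s) * f s) s := by
  unfold weighted
  by_cases h : s ∈ box t
  · have h' := mem_box_iff.1 h
    rw [Set.indicator_of_mem h'.1, Set.indicator_of_mem h'.2, Set.indicator_of_mem h]
    have : -∑ i, t i * x i = -∑ i, s i * x i + -∑ i, (t - s) i * x i := by
      simp only [Pi.sub_apply, sub_mul, Finset.sum_sub_distrib]; ring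
    rw [this, Real.exp_add]
    simp only [laplaceIntegrand]
    ring
  · rw [Set.indicator_of_notMem h, mul_zero]
    rw [mem_box_iff, not_and_or] at h
    rcases h with h | h <;> simp [Set.indicator_of_notMem h]

/-- The exponential weight is multiplicative, and `s` and `t - s` both lie in the orthant exactly
when `s ∈ box t`. No integrability is needed: both sides are the same integral for every `t`, and
vanish off the orthant. -/
theorem weighted_conv (k f : (Fin n → ℝ) → ℝ) (x : Fin n → ℝ) :
    weighted (conv k f) x =
      convolution (weighted f x) (weighted k x) (ContinuousLinearMap.mul ℝ ℝ) volume := by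
  ext t
  simp only [convolution, ContinuousLinearMap.mul_apply', weighted_mul_weighted_sub]
  rw [integral_const_mul, integral_indicator (measurableSet_box t), weighted]
  by_cases h : t ∈ orthant n
  · rw [Set.indicator_of_mem h, laplaceIntegrand, conv, mul_comm]
  · simp [Set.indicator_of_notMem h, box_eq_empty h]

theorem LaplaceTransformable.conv {k f : (Fin n → ℝ) → ℝ} (hk : LaplaceTransformable k)
    (hf : LaplaceTransformable f) : LaplaceTransformable (conv k f) := by
  intro x hx
  rw [← integrable_weighted_iff, weighted_conv]
  exact (hf.integrable_weighted hx).integrable_convolution _ (hk.integrable_weighted hx)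

/-- The Laplace transform turns convolutions into products. -/
theorem laplace_conv {k f : (Fin n → ℝ) → ℝ} (hk : LaplaceTransformable k)
    (hf : LaplaceTransformable f) {x : Fin n → ℝ} (hx : x ∈ orthant n) :
    laplace (conv k f) x = laplace k x * laplace f x := by
  rw [← integral_weighted, weighted_conv,
    integral_convolution _ (hf.integrable_weighted hx) (hk.integrable_weighted hx),
    integral_weighted, integral_weighted, ContinuousLinearMap.mul_apply', mul_comm]

theorem ones_mem_orthant (n : ℕ) : (1 : Fin n → ℝ) ∈ orthant n := fun _ => one_pos

theorem LaplaceTransformable.ae_integrableOn_box {k f : (Fin n → ℝ) → ℝ}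
    (hk : LaplaceTransformable k) (hf : LaplaceTransformable f) :
    ∀ᵐ t : Fin n → ℝ, IntegrableOn (fun s => k (t - s) * f s) (box t) := by
  have h1 := ones_mem_orthant n
  filter_upwards [(hf.integrable_weighted h1).ae_convolution_exists
    (ContinuousLinearMap.mul ℝ ℝ) (hk.integrable_weighted h1)] with t ht
  simp only [ConvolutionExistsAt, ContinuousLinearMap.mul_apply', weighted_mul_weighted_sub] at ht
  rwa [integrable_const_mul_iff (Real.exp_ne_zero _).isUnit,
    integrable_indicator_iff (measurableSet_box t)] at ht

theorem AEEq.laplace_eq {f g : (Fin n → ℝ) → ℝ} (h : AEEq f g) (x : Fin n → ℝ) :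
    laplace f x = laplace g x := by
  refine integral_congr_ae ?_
  filter_upwards [h] with s hs
  simp [laplaceIntegrand, hs]

theorem AEEq.weighted_ae_eq {f g : (Fin n → ℝ) → ℝ} (h : AEEq f g) (x : Fin n → ℝ) :
    weighted f x =ᵐ[volume] weighted g x := by
  rw [AEEq, ae_restrict_iff' (measurableSet_orthant n)] at h
  filter_upwards [h] with s hs
  by_cases hso : s ∈ orthant n
  · simp [weighted, hso, laplaceIntegrand, hs hso]
  · simp [weighted, hso]

theorem AEEq.conv_left {k l : (Fin n → ℝ) → ℝ} (h : AEEq k l) (f : (Fin n → ℝ) → ℝ) :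
    AEEq (conv k f) (conv l f) := by
  -- At `x = 0` the exponential is 1, so `weighted` is plain extension by zero.
  have key : weighted (conv k f) 0 = weighted (conv l f) 0 := by
    rw [weighted_conv, weighted_conv]
    exact convolution_congr _ (ae_eq_refl _) (h.weighted_ae_eq 0)
  refine (ae_restrict_iff' (measurableSet_orthant n)).2 (ae_of_all _ fun t ht => ?_)
  simpa [weighted, ht, laplaceIntegrand] using congrFun key t

theorem rlIntegral_eq_conv (α : Fin n → ℝ) (f : (Fin n → ℝ) → ℝ) :
    rlIntegral α f = conv (rlKernel α) f := by
  ext t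
  rw [rlIntegral, conv, ← integral_const_mul]
  refine integral_congr_ae (ae_of_all _ fun s => ?_)
  simp only [rlKernel, Pi.sub_apply]
  ring

/-! ### Laplace transforms of the Riemann–Liouville kernels -/

theorem volume_restrict_orthant (n : ℕ) :
    (volume : Measure (Fin n → ℝ)).restrict (orthant n) =
      Measure.pi fun _ => (volume : Measure ℝ).restrict (Set.Ioi 0) := by
  rw [← Measure.restrict_pi_pi]
  congr 1
  ext; simp [orthant]

theorem laplaceIntegrand_rlKernel (α x : Fin n → ℝ) :
    laplaceIntegrand (rlKernel α) x = fun s =>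
      ∏ i, (Real.Gamma (α i))⁻¹ * (s i ^ (α i - 1) * Real.exp (-(x i * s i))) := by
  ext s
  rw [laplaceIntegrand, rlKernel, ← Finset.sum_neg_distrib, Real.exp_sum,
    Finset.prod_mul_distrib, Finset.prod_mul_distrib, Finset.prod_inv_distrib]
  simp only [mul_comm (x _)]
  ring

theorem laplaceTransformable_rlKernel {α : Fin n → ℝ} (hα : α ∈ orthant n) :
    LaplaceTransformable (rlKernel α) := by
  intro x hx
  rw [IntegrableOn, volume_restrict_orthant, laplaceIntegrand_rlKernel]
  refine Integrable.fintype_prod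
    (f := fun i y => (Real.Gamma (α i))⁻¹ * (y ^ (α i - 1) * Real.exp (-(x i * y)))) fun i => ?_
  have := integrableOn_rpow_mul_exp_neg_mul_rpow (p := 1) (s := α i - 1)
    (by linarith [hα i]) one_pos (hx i)
  simp only [Real.rpow_one, neg_mul] at this
  exact this.const_mul _

theorem laplace_rlKernel {α x : Fin n → ℝ} (hα : α ∈ orthant n) (hx : x ∈ orthant n) :
    laplace (rlKernel α) x = ∏ i, (x i ^ α i)⁻¹ := by
  rw [laplace, volume_restrict_orthant, laplaceIntegrand_rlKernel,
    integral_fintype_prod_eq_prod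
      (fun i y => (Real.Gamma (α i))⁻¹ * (y ^ (α i - 1) * Real.exp (-(x i * y))))]
  refine Finset.prod_congr rfl fun i _ => ?_
  rw [integral_const_mul, Real.integral_rpow_mul_exp_neg_mul_Ioi (hα i) (hx i), one_div,
    Real.inv_rpow (hx i).le]
  have := (Real.Gamma_pos_of_pos (hα i)).ne'
  field_simp

theorem laplace_rlKernel_ne_zero {α x : Fin n → ℝ} (hα : α ∈ orthant n) (hx : x ∈ orthant n) :
    laplace (rlKernel α) x ≠ 0 := by
  rw [laplace_rlKernel hα hx]
  exact (Finset.prod_pos fun i _ => inv_pos.2 (Real.rpow_pos_of_pos (hx i) _)).ne'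

/-! ### Injectivity of the Laplace transform -/

/-- An integrable function that is orthogonal to a point-separating algebra of bounded continuous
functions vanishes almost everywhere. -/
theorem ae_eq_zero_of_forall_mem_subalgebra_integral_eq_zero {E : Type*} [MeasurableSpace E]
    [TopologicalSpace E] [PolishSpace E] [BorelSpace E] {μ : Measure E} {G : E → ℝ}
    (hG : Integrable G μ) {A : StarSubalgebra ℝ (BoundedContinuousFunction E ℝ)}
    (hA : (A.map (BoundedContinuousFunction.toContinuousMapStarₐ ℝ)).SeparatesPoints)
    (h : ∀ g ∈ A, ∫ y, g y * G y ∂μ = 0) : G =ᵐ[μ] 0 := by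
  have hfin : ∀ H : E → ℝ, Integrable H μ →
      IsFiniteMeasure (μ.withDensity fun y => ENNReal.ofReal (H y)) := fun H hH =>
    isFiniteMeasure_withDensity_ofReal hH.2
  have := hfin G hG
  have := hfin (-G) hG.neg
  have hint : ∀ H : E → ℝ, Integrable H μ → ∀ g : BoundedContinuousFunction E ℝ,
      ∫ y, g y ∂(μ.withDensity fun y => ENNReal.ofReal (H y)) = ∫ y, g y * max (H y) 0 ∂μ := by
    intro H hH g
    rw [integral_withDensity_eq_integral_toReal_smul₀ hH.1.aemeasurable.ennreal_ofReal
      (ae_of_all _ fun _ => ENNReal.ofReal_lt_top)]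
    simp [ENNReal.toReal_ofReal', mul_comm]
  have hintg : ∀ H : E → ℝ, Integrable H μ → ∀ g : BoundedContinuousFunction E ℝ,
      Integrable (fun y => g y * H y) μ := fun H hH g =>
    hH.bdd_mul (c := ‖g‖) g.continuous.aestronglyMeasurable (ae_of_all _ g.norm_coe_le_norm)
  -- The positive and negative parts of `G` are densities of finite measures that agree on the
  -- algebra, hence are equal. As one part vanishes at each point, both are zero almost everywhere.
  have heq := ext_of_forall_mem_subalgebra_integral_eq_of_polish
    (P := μ.withDensity fun y => ENNReal.ofReal (G y))
    (P' := μ.withDensity fun y => ENNReal.ofReal ((-G) y)) hA fun g hg => by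
      rw [hint _ hG, hint _ hG.neg, ← sub_eq_zero,
        ← integral_sub (hintg _ hG.pos_part g) (hintg _ hG.neg.pos_part g)]
      refine (integral_congr_ae (ae_of_all _ fun y => ?_)).trans (h g hg)
      simp only [Pi.neg_apply]
      rw [← mul_sub]
      congr 1
      exact max_zero_sub_max_neg_zero_eq_self (G y)
  rw [withDensity_eq_iff hG.1.aemeasurable.ennreal_ofReal hG.neg.1.aemeasurable.ennreal_ofReal
    (by simpa using measure_ne_top (μ.withDensity fun y => ENNReal.ofReal (G y)) Set.univ)] at heq
  filter_upwards [heq] with y hy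
  rcases le_total (G y) 0 with h0 | h0
  · rw [ENNReal.ofReal_of_nonpos h0, eq_comm, ENNReal.ofReal_eq_zero, Pi.neg_apply] at hy
    simp; linarith
  · rw [ENNReal.ofReal_of_nonpos (p := (-G) y) (by simpa), ENNReal.ofReal_eq_zero] at hy
    simp; linarith

/-- The function `s ↦ e^{-m·s}` on the orthant, as a bounded continuous function. -/
noncomputable def expChar (m : Fin n → ℕ) : BoundedContinuousFunction (orthant n) ℝ :=
  BoundedContinuousFunction.ofNormedAddCommGroup
    (fun s => Real.exp (-∑ i, s.1 i * (m i : ℝ)))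
    (Real.continuous_exp.comp (continuous_finsetSum _ fun i _ =>
      ((continuous_apply i).comp continuous_subtype_val).mul continuous_const).neg) 1 fun s => by
      rw [Real.norm_eq_abs, Real.abs_exp, Real.exp_le_one_iff, neg_nonpos]
      exact Finset.sum_nonneg fun i _ => mul_nonneg (s.2 i).le (Nat.cast_nonneg _)

theorem expChar_apply (m : Fin n → ℕ) (s : orthant n) :
    expChar m s = Real.exp (-∑ i, s.1 i * (m i : ℝ)) := rfl

/-- The multiplicative family of the functions `expChar m`. -/
noncomputable def expCharHom (n : ℕ) :
    Multiplicative (Fin n → ℕ) →* BoundedContinuousFunction (orthant n) ℝ where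
  toFun m := expChar m.toAdd
  map_one' := by ext s; simp [expChar_apply]
  map_mul' a b := by
    ext s
    simp only [BoundedContinuousFunction.coe_mul, Pi.mul_apply, expChar_apply, ← Real.exp_add]
    congr 1
    simp only [toAdd_mul, Pi.add_apply, Nat.cast_add, mul_add, Finset.sum_add_distrib]
    ring

/-- The algebra spanned by the functions `s ↦ e^{-m·s}`. -/
noncomputable def expAlgebra (n : ℕ) :
    StarSubalgebra ℝ (BoundedContinuousFunction (orthant n) ℝ) where
  toSubalgebra := Algebra.adjoin ℝ (MonoidHom.mrange (expCharHom n))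
  star_mem' {a} ha := by
    have : star a = a := by ext; simp
    rwa [this]

theorem expAlgebra_separatesPoints (n : ℕ) :
    ((expAlgebra n).map (BoundedContinuousFunction.toContinuousMapStarₐ ℝ)).SeparatesPoints := by
  intro s t hst
  obtain ⟨i, hi⟩ := Function.ne_iff.1 fun h => hst (Subtype.ext h)
  refine ⟨_, ⟨_, ⟨expChar (Pi.single i 1), Algebra.subset_adjoin
    ⟨Multiplicative.ofAdd (Pi.single i 1), rfl⟩, rfl⟩, rfl⟩, fun h => hi ?_⟩
  have h' : expChar (Pi.single i 1) s = expChar (Pi.single i 1) t := h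
  simpa [expChar_apply, Pi.single_apply] using h'

/-- The exponentials form a monoid under multiplication, so the algebra they generate is their
linear span and no product case arises. -/
theorem expAlgebra_induction {p : BoundedContinuousFunction (orthant n) ℝ → Prop}
    (hexp : ∀ m, p (expChar m)) (hzero : p 0) (hadd : ∀ a b, p a → p b → p (a + b))
    (hsmul : ∀ (c : ℝ) a, p a → p (c • a)) {g : BoundedContinuousFunction (orthant n) ℝ}
    (hg : g ∈ expAlgebra n) : p g := by
  have hg' : g ∈ Subalgebra.toSubmodule (Algebra.adjoin ℝ
    (MonoidHom.mrange (expCharHom n) : Set (BoundedContinuousFunction (orthant n) ℝ))) := hg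
  clear hg
  rw [Algebra.adjoin_eq_span, Submonoid.closure_eq] at hg'
  induction hg' using Submodule.span_induction with
  | mem y hy => obtain ⟨m, rfl⟩ := hy; exact hexp _
  | zero => exact hzero
  | add a b _ _ ha hb => exact hadd a b ha hb
  | smul c a _ ha => exact hsmul c a ha

/-- A function on the orthant is determined by its Laplace transform. -/
theorem LaplaceTransformable.aeEq_of_laplace_eq {f g : (Fin n → ℝ) → ℝ}
    (hf : LaplaceTransformable f) (hg : LaplaceTransformable g)
    (h : ∀ x ∈ orthant n, laplace f x = laplace g x) : AEEq f g := by
  have hpolish : PolishSpace (orthant n) := (isOpen_orthant n).polishSpace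
  have h1 := ones_mem_orthant n
  have hd : ∀ x ∈ orthant n, IntegrableOn (laplaceIntegrand (f - g) x) (orthant n) ∧
      ∫ s in orthant n, laplaceIntegrand (f - g) x s = 0 := by
    intro x hx
    have : laplaceIntegrand (f - g) x = laplaceIntegrand f x - laplaceIntegrand g x := by
      ext s; simp [laplaceIntegrand, sub_mul]
    rw [this]
    refine ⟨(hf x hx).sub (hg x hx), ?_⟩
    have := h x hx
    rw [laplace, laplace] at this
    rw [integral_sub' (hf x hx) (hg x hx), this, sub_self]
  have hint := (integrableOn_iff_comap_subtypeVal (measurableSet_orthant n)).1 (hd 1 h1).1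
  have hae := ae_eq_zero_of_forall_mem_subalgebra_integral_eq_zero
    (μ := Measure.comap ((↑) : orthant n → Fin n → ℝ) volume)
    (G := fun s => laplaceIntegrand (f - g) 1 s)
    hint
    (expAlgebra_separatesPoints n) fun a ha => by
      refine expAlgebra_induction (p := fun a => ∫ s, a s * laplaceIntegrand (f - g) 1 s
        ∂(Measure.comap ((↑) : orthant n → Fin n → ℝ) volume) = 0)
        (fun m => ?_) ?_ (fun a b ha hb => ?_) (fun c a ha => ?_) ha
      -- Multiplying the integrand at 1 by `e^{-m·s}` gives the integrand at `1 + m`. The base point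
      -- 1 keeps this in the open orthant even where `m i = 0`.
      · have hm : (1 : Fin n → ℝ) + (fun i => (m i : ℝ)) ∈ orthant n := fun i => by
          simp only [Pi.add_apply, Pi.one_apply]; positivity
        rw [← (hd _ hm).2, ← integral_subtype_comap (measurableSet_orthant n)]
        refine integral_congr_ae (ae_of_all _ fun s => ?_)
        simp only [expChar_apply, laplaceIntegrand]
        rw [mul_left_comm, ← Real.exp_add]
        congr 2
        simp only [Pi.add_apply, mul_add, Finset.sum_add_distrib]
        ring
      · simp
      · have hbdd : ∀ a : BoundedContinuousFunction (orthant n) ℝ,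
            Integrable (fun s => a s * laplaceIntegrand (f - g) 1 s)
              (Measure.comap ((↑) : orthant n → Fin n → ℝ) volume) := fun a =>
          hint.bdd_mul (c := ‖a‖) a.continuous.aestronglyMeasurable (ae_of_all _ a.norm_coe_le_norm)
        simp only [BoundedContinuousFunction.coe_add, Pi.add_apply, add_mul]
        rw [integral_add (hbdd a) (hbdd b), ha, hb, add_zero]
      · simp only [BoundedContinuousFunction.coe_smul, smul_eq_mul, mul_assoc]
        rw [integral_const_mul, ha, mul_zero]
  rw [AEEq, ae_restrict_iff_subtype (measurableSet_orthant n)]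
  filter_upwards [hae] with s hs
  simpa [laplaceIntegrand, sub_eq_zero] using hs

/-! ### Cauchy's functional equation on the orthant -/

/-- The extension to `ℝⁿ` of a function that is additive on the open orthant. -/
noncomputable def additiveExtension (L : (Fin n → ℝ) → ℝ)
    (hL : ∀ α ∈ orthant n, ∀ β ∈ orthant n, L (α + β) = L α + L β) : (Fin n → ℝ) →+ ℝ :=
  have hp : ∀ v : Fin n → ℝ, v ⊔ 0 + 1 ∈ orthant n := fun v i => by
    have : (0 : ℝ) ≤ v i ⊔ 0 := le_sup_right
    simp only [Pi.add_apply, Pi.sup_apply, Pi.zero_apply, Pi.one_apply]; linarith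
  -- Positive and negative parts of `v` lie only in the closed orthant; adding 1 to both moves them
  -- into the open one without changing their difference.
  AddMonoidHom.mk' (fun v => L (v ⊔ 0 + 1) - L (-v ⊔ 0 + 1)) fun v w => by
    have hsplit : ∀ v : Fin n → ℝ, v ⊔ 0 = v + (-v ⊔ 0) := fun v => by
      ext i
      simp only [Pi.add_apply, Pi.sup_apply, Pi.zero_apply, Pi.neg_apply]
      have := max_zero_sub_max_neg_zero_eq_self (v i)
      linarith
    have h := congrArg L (show (v + w) ⊔ 0 + 1 + (-v ⊔ 0 + 1 + (-w ⊔ 0 + 1)) =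
        -(v + w) ⊔ 0 + 1 + (v ⊔ 0 + 1 + (w ⊔ 0 + 1)) by
      rw [hsplit (v + w), hsplit v, hsplit w]; abel)
    rw [hL _ (hp _) _ (add_mem_orthant (hp _) (hp _)), hL _ (hp _) _ (hp _),
      hL _ (hp _) _ (add_mem_orthant (hp _) (hp _)), hL _ (hp _) _ (hp _)] at h
    linarith

theorem additiveExtension_sub {L : (Fin n → ℝ) → ℝ}
    (hL : ∀ α ∈ orthant n, ∀ β ∈ orthant n, L (α + β) = L α + L β) {α β : Fin n → ℝ}
    (hα : α ∈ orthant n) (hβ : β ∈ orthant n) :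
    additiveExtension L hL (α - β) = L α - L β := by
  have hp : ∀ v : Fin n → ℝ, v ⊔ 0 + 1 ∈ orthant n := fun v i => by
    have : (0 : ℝ) ≤ v i ⊔ 0 := le_sup_right
    simp only [Pi.add_apply, Pi.sup_apply, Pi.zero_apply, Pi.one_apply]; linarith
  have h := congrArg L (show (α - β) ⊔ 0 + 1 + β = -(α - β) ⊔ 0 + 1 + α by
    ext i
    simp only [Pi.add_apply, Pi.sup_apply, Pi.zero_apply, Pi.neg_apply, Pi.sub_apply]
    have := max_zero_sub_max_neg_zero_eq_self (α i - β i)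
    linarith)
  rw [hL _ (hp _) _ hβ, hL _ (hp _) _ hα] at h
  change L ((α - β) ⊔ 0 + 1) - L (-(α - β) ⊔ 0 + 1) = _
  linarith

theorem additiveExtension_apply {L : (Fin n → ℝ) → ℝ}
    (hL : ∀ α ∈ orthant n, ∀ β ∈ orthant n, L (α + β) = L α + L β) {α : Fin n → ℝ}
    (hα : α ∈ orthant n) : additiveExtension L hL α = L α := by
  have := additiveExtension_sub hL (add_mem_orthant hα hα) hα
  rwa [add_sub_cancel_right, hL _ hα _ hα, add_sub_cancel_right] at this

open Filter Topology in
/-- An additive function on the orthant that is continuous at one point and vanishes at `n` linearly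
independent vectors is zero. -/
theorem eq_zero_of_additive_of_continuousAtSomePoint {L : (Fin n → ℝ) → ℝ}
    (hL : ∀ α ∈ orthant n, ∀ β ∈ orthant n, L (α + β) = L α + L β)
    (hc : ContinuousAtSomePoint L) {a : Fin n → Fin n → ℝ} (ha : LinearIndependent ℝ a)
    (hao : ∀ j, a j ∈ orthant n) (haL : ∀ j, L (a j) = 0) {α : Fin n → ℝ} (hα : α ∈ orthant n) :
    L α = 0 := by
  obtain ⟨α₀, hα₀, hc⟩ := hc
  have hnhds := (isOpen_orthant n).mem_nhds hα₀
  have hc' := hc.continuousAt hnhds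
  have hcont : Continuous (additiveExtension L hL) := by
    refine continuous_of_continuousAt_zero _ ?_
    have hadd : Tendsto (fun v : Fin n → ℝ => α₀ + v) (𝓝 0) (𝓝 α₀) := by
      simpa using (tendsto_const_nhds (x := α₀)).add (tendsto_id (x := 𝓝 (0 : Fin n → ℝ)))
    have hlim : Tendsto (fun v => L (α₀ + v) - L α₀) (𝓝 0) (𝓝 0) := by
      simpa using (hc'.tendsto.comp hadd).sub_const (L α₀)
    rw [ContinuousAt, map_zero]
    refine hlim.congr' ?_
    -- For small `v`, `α₀ + v` stays in the orthant, so the extension at `v` is the increment of `L`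
    -- at `α₀`.
    filter_upwards [hadd hnhds] with v hv
    rw [← additiveExtension_sub hL hv hα₀, add_sub_cancel_left]
  let G := (additiveExtension L hL).toRealLinearMap hcont
  have hG : ∀ v, G v = additiveExtension L hL v := fun _ => rfl
  have hzero : (G : (Fin n → ℝ) →ₗ[ℝ] ℝ) = 0 :=
    LinearMap.ext_on_range (ha.span_eq_top_of_card_eq_finrank' (by simp)) fun j => by
      simp [hG, additiveExtension_apply hL (hao j), haL j]
  rw [← additiveExtension_apply hL hα, ← hG]
  exact LinearMap.congr_fun hzero α

/-- A multiplicative function on the orthant that is continuous at one point and equals one at `n`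
linearly independent vectors is constant. -/
theorem eq_one_of_multiplicative_of_continuousAtSomePoint (hn : 1 ≤ n) {φ : (Fin n → ℝ) → ℝ}
    (hφ : ∀ α ∈ orthant n, ∀ β ∈ orthant n, φ (α + β) = φ α * φ β)
    (hc : ContinuousAtSomePoint φ) {a : Fin n → Fin n → ℝ} (ha : LinearIndependent ℝ a)
    (hao : ∀ j, a j ∈ orthant n) (haφ : ∀ j, φ (a j) = 1) {α : Fin n → ℝ} (hα : α ∈ orthant n) :
    φ α = 1 := by
  -- Some positive multiple of `a j` exceeds `β` in every coordinate. There `φ` is 1 and has `φ β`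
  -- as a factor. The vector `a j` exists because `n ≥ 1`.
  have hne : ∀ β ∈ orthant n, φ β ≠ 0 := by
    intro β hβ h0
    let j : Fin n := ⟨0, hn⟩
    have hpow : ∀ m : ℕ, ((m + 1 : ℕ) : ℝ) • a j ∈ orthant n ∧ φ (((m + 1 : ℕ) : ℝ) • a j) = 1 := by
      intro m
      induction m with
      | zero => simpa using ⟨hao j, haφ j⟩
      | succ m ih =>
        rw [Nat.cast_succ (m + 1), add_smul, one_smul]
        exact ⟨add_mem_orthant ih.1 (hao j), by rw [hφ _ ih.1 _ (hao j), ih.2, haφ, one_mul]⟩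
    obtain ⟨m, hm⟩ := exists_nat_gt (∑ i, β i / a j i)
    have hsub : ((m + 1 : ℕ) : ℝ) • a j - β ∈ orthant n := fun i => by
      have h1 : β i / a j i ≤ ∑ i, β i / a j i :=
        Finset.single_le_sum (f := fun i => β i / a j i)
          (fun i _ => (div_pos (hβ i) (hao j i)).le) (Finset.mem_univ i)
      have h2 := (div_lt_iff₀ (hao j i)).1 (h1.trans_lt hm)
      have h3 := hao j i
      simp only [Pi.sub_apply, Pi.smul_apply, smul_eq_mul, Nat.cast_succ]
      linarith
    have h1 := (hpow m).2
    rw [← add_sub_cancel β (((m + 1 : ℕ) : ℝ) • a j), hφ _ hβ _ hsub, h0, zero_mul] at h1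
    exact zero_ne_one h1
  have hpos : ∀ β ∈ orthant n, 0 < φ β := by
    intro β hβ
    have hh : (2⁻¹ : ℝ) • β ∈ orthant n := fun i => by
      have := hβ i
      simp only [Pi.smul_apply, smul_eq_mul]; positivity
    -- Halving `β` exhibits `φ β` as a nonzero square.
    have : β = (2⁻¹ : ℝ) • β + (2⁻¹ : ℝ) • β := by
      rw [← add_smul]; norm_num
    rw [this, hφ _ hh _ hh]
    exact mul_self_pos.2 (hne _ hh)
  have hlog := eq_zero_of_additive_of_continuousAtSomePoint (L := fun β => Real.log (φ β))
    (fun β hβ γ hγ => by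
      simp only [hφ _ hβ _ hγ]; exact Real.log_mul (hne _ hβ) (hne _ hγ))
    (by
      obtain ⟨α₀, hα₀, hc⟩ := hc
      exact ⟨α₀, hα₀, hc.log (hne _ hα₀)⟩) ha hao (fun j => by simp [haφ]) hα
  exact Real.eq_one_of_pos_of_log_eq_zero (hpos _ hα) hlog

theorem ContinuousAtSomePoint.congr {F G : (Fin n → ℝ) → ℝ} (hF : ContinuousAtSomePoint F)
    (h : ∀ α ∈ orthant n, G α = F α) : ContinuousAtSomePoint G := by
  obtain ⟨α₀, hα₀, hc⟩ := hF
  exact ⟨α₀, hα₀, hc.congr h (h _ hα₀)⟩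

theorem ContinuousAtSomePoint.mul_continuousOn {F G : (Fin n → ℝ) → ℝ}
    (hF : ContinuousAtSomePoint F) (hG : ContinuousOn G (orthant n)) :
    ContinuousAtSomePoint fun α => F α * G α := by
  obtain ⟨α₀, hα₀, hc⟩ := hF
  exact ⟨α₀, hα₀, hc.mul (hG _ hα₀)⟩

/-! ### Characterization of the kernels -/

/-- Convolution with `k` is a Riemann–Liouville integral if and only if `k` is a
Riemann–Liouville kernel. -/
theorem aeEq_rlKernel_iff {k : (Fin n → ℝ) → ℝ} (hk : LaplaceTransformable k) {α : Fin n → ℝ}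
    (hα : α ∈ orthant n) :
    AEEq k (rlKernel α) ↔ ∀ f : (Fin n → ℝ) → ℝ, LaplaceTransformable f →
      AEEq (conv k f) (rlIntegral α f) := by
  have hrl := laplaceTransformable_rlKernel hα
  refine ⟨fun h f _ => ?_, fun h => hk.aeEq_of_laplace_eq hrl fun x hx => ?_⟩
  · rw [rlIntegral_eq_conv]
    exact h.conv_left f
  -- The kernel itself serves as test function: its transform is nonzero and cancels.
  · have h' := (h _ hrl).laplace_eq x
    rw [rlIntegral_eq_conv, laplace_conv hk hrl hx, laplace_conv hrl hrl hx] at h'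
    exact mul_right_cancel₀ (laplace_rlKernel_ne_zero hα hx) h'

theorem continuousAtSomePoint_laplace_iff {K : (Fin n → ℝ) → (Fin n → ℝ) → ℝ}
    (hK : ∀ α ∈ orthant n, LaplaceTransformable (K α)) :
    (∀ x ∈ orthant n, ContinuousAtSomePoint (fun α => laplace (K α) x)) ↔
      ∀ f : (Fin n → ℝ) → ℝ, LaplaceTransformable f → ∀ x ∈ orthant n,
        ContinuousAtSomePoint (fun α => laplace (conv (K α) f) x) := by
  refine ⟨fun h f hf x hx => ?_, fun h x hx => ?_⟩
  · exact ((h x hx).mul_continuousOn (continuousOn_const (c := laplace f x))).congr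
      fun α hα => laplace_conv (hK α hα) hf hx
  · have h1 := ones_mem_orthant n
    have hrl := laplaceTransformable_rlKernel h1
    refine ((h _ hrl x hx).mul_continuousOn
      (continuousOn_const (c := (laplace (rlKernel 1) x)⁻¹))).congr fun α hα => ?_
    rw [laplace_conv (hK α hα) hrl hx, mul_inv_cancel_right₀ (laplace_rlKernel_ne_zero h1 hx)]

/-- A family of kernels that satisfies the index law, contains the Riemann–Liouville kernels of `n`
linearly independent orders, and whose Laplace transforms are each continuous in the order at some
point, consists of the Riemann–Liouville kernels. -/
theorem aeEq_rlKernel_of_index_law (hn : 1 ≤ n) {K : (Fin n → ℝ) → (Fin n → ℝ) → ℝ}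
    (hK : ∀ α ∈ orthant n, LaplaceTransformable (K α))
    {a : Fin n → (Fin n → ℝ)} (ha : LinearIndependent ℝ a) (hao : ∀ j, a j ∈ orthant n)
    (haK : ∀ j, AEEq (K (a j)) (rlKernel (a j)))
    (hidx : ∀ α ∈ orthant n, ∀ β ∈ orthant n, ∀ f : (Fin n → ℝ) → ℝ, LaplaceTransformable f →
      AEEq (conv (K (α + β)) f) (conv (K α) (conv (K β) f)))
    (hc : ∀ x ∈ orthant n, ContinuousAtSomePoint (fun α => laplace (K α) x))
    {α : Fin n → ℝ} (hα : α ∈ orthant n) : AEEq (K α) (rlKernel α) := by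
  refine (hK α hα).aeEq_of_laplace_eq (laplaceTransformable_rlKernel hα) fun x hx => ?_
  have hmul : ∀ β ∈ orthant n, ∀ γ ∈ orthant n,
      laplace (K (β + γ)) x = laplace (K β) x * laplace (K γ) x := by
    intro β hβ γ hγ
    have h1 := ones_mem_orthant n
    have hrl := laplaceTransformable_rlKernel h1
    have h := (hidx β hβ γ hγ _ hrl).laplace_eq x
    rw [laplace_conv (hK _ (add_mem_orthant hβ hγ)) hrl hx,
      laplace_conv (hK _ hβ) ((hK _ hγ).conv hrl) hx, laplace_conv (hK _ hγ) hrl hx,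
      ← mul_assoc] at h
    exact mul_right_cancel₀ (laplace_rlKernel_ne_zero h1 hx) h
  have hpos : ∀ β : Fin n → ℝ, 0 < ∏ i, x i ^ β i := fun β =>
    Finset.prod_pos fun i _ => Real.rpow_pos_of_pos (hx i) _
  have hrl : ∀ β ∈ orthant n, laplace (rlKernel β) x = (∏ i, x i ^ β i)⁻¹ := fun β hβ => by
    rw [laplace_rlKernel hβ hx, Finset.prod_inv_distrib]
  have hcont : Continuous fun β : Fin n → ℝ => ∏ i, x i ^ β i :=
    continuous_finsetProd _ fun i _ => Real.continuous_const_rpow (hx i).ne' |>.comp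
      (continuous_apply i)
  -- This `φ` is the quotient of the transforms of `K β` and of the Riemann–Liouville kernel.
  have h := eq_one_of_multiplicative_of_continuousAtSomePoint hn
    (φ := fun β => laplace (K β) x * ∏ i, x i ^ β i)
    (fun β hβ γ hγ => by
      simp only [hmul β hβ γ hγ, Pi.add_apply, Real.rpow_add (hx _), Finset.prod_mul_distrib]
      ring)
    ((hc x hx).mul_continuousOn hcont.continuousOn) ha hao
    (fun j => by
      simp only [(haK j).laplace_eq x, hrl _ (hao j)]
      exact inv_mul_cancel₀ (hpos _).ne') hα
  rw [hrl α hα]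
  exact eq_inv_of_mul_eq_one_left h

theorem ae_integrableOn_rlIntegral {α : Fin n → ℝ} (hα : α ∈ orthant n) {f : (Fin n → ℝ) → ℝ}
    (hf : LaplaceTransformable f) :
    ∀ᵐ t : Fin n → ℝ, IntegrableOn (fun s => (∏ i, (t i - s i) ^ (α i - 1)) * f s) (box t) := by
  have hG : ∏ i, Real.Gamma (α i) ≠ 0 :=
    (Finset.prod_pos fun i _ => Real.Gamma_pos_of_pos (hα i)).ne'
  filter_upwards [(laplaceTransformable_rlKernel hα).ae_integrableOn_box hf] with t ht
  refine (ht.const_mul (∏ i, Real.Gamma (α i))).congr (ae_of_all _ fun s => ?_)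
  simp only [rlKernel, Pi.sub_apply]
  field_simp

end MultiRL

theorem mainTheorem9 (n : ℕ) (hn : 1 ≤ n)
    (K : (Fin n → ℝ) → (Fin n → ℝ) → ℝ)
    (hK : ∀ α ∈ MultiRL.orthant n, MultiRL.LaplaceTransformable (K α)) :
    -- the operators `J^α f = K_α ∗ f` are well defined and map Laplace transformable functions
    -- to Laplace transformable functions
    (∀ α ∈ MultiRL.orthant n, ∀ f : (Fin n → ℝ) → ℝ, MultiRL.LaplaceTransformable f →
      (∀ᵐ t ∂(MeasureTheory.volume.restrict (MultiRL.orthant n)),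
        MeasureTheory.IntegrableOn (fun s => K α (t - s) * f s) (MultiRL.box t)) ∧
      MultiRL.LaplaceTransformable (MultiRL.conv (K α) f)) ∧
    -- the two forms of the identity condition agree at each order
    (∀ α ∈ MultiRL.orthant n,
      (MultiRL.AEEq (K α) (MultiRL.rlKernel α) ↔
        ∀ f : (Fin n → ℝ) → ℝ, MultiRL.LaplaceTransformable f →
          MultiRL.AEEq (MultiRL.conv (K α) f) (MultiRL.rlIntegral α f))) ∧
    -- the two forms of the continuity condition agree
    ((∀ x ∈ MultiRL.orthant n,
        MultiRL.ContinuousAtSomePoint (fun α => MultiRL.laplace (K α) x)) ↔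
      ∀ f : (Fin n → ℝ) → ℝ, MultiRL.LaplaceTransformable f → ∀ x ∈ MultiRL.orthant n,
        MultiRL.ContinuousAtSomePoint (fun α => MultiRL.laplace (MultiRL.conv (K α) f) x)) ∧
    -- identity, index law and continuity characterize the Riemann–Liouville integral
    ((∃ a : Fin n → (Fin n → ℝ), LinearIndependent ℝ a ∧
        ∀ j, a j ∈ MultiRL.orthant n ∧ MultiRL.AEEq (K (a j)) (MultiRL.rlKernel (a j))) →
      (∀ α ∈ MultiRL.orthant n, ∀ β ∈ MultiRL.orthant n,
        ∀ f : (Fin n → ℝ) → ℝ, MultiRL.LaplaceTransformable f →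
          MultiRL.AEEq (MultiRL.conv (K (α + β)) f)
            (MultiRL.conv (K α) (MultiRL.conv (K β) f))) →
      (∀ x ∈ MultiRL.orthant n,
        MultiRL.ContinuousAtSomePoint (fun α => MultiRL.laplace (K α) x)) →
      ∀ α ∈ MultiRL.orthant n, ∀ f : (Fin n → ℝ) → ℝ, MultiRL.LaplaceTransformable f →
        (∀ᵐ t ∂(MeasureTheory.volume.restrict (MultiRL.orthant n)),
          MeasureTheory.IntegrableOn (fun s => (∏ i, (t i - s i) ^ (α i - 1)) * f s)
            (MultiRL.box t)) ∧
        MultiRL.AEEq (MultiRL.conv (K α) f) (MultiRL.rlIntegral α f)) := by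
  refine ⟨fun α hα f hf => ⟨ae_restrict_of_ae ((hK α hα).ae_integrableOn_box hf),
    (hK α hα).conv hf⟩, fun α hα => MultiRL.aeEq_rlKernel_iff (hK α hα) hα,
    MultiRL.continuousAtSomePoint_laplace_iff hK, ?_⟩
  rintro ⟨a, ha, haK⟩ hidx hc α hα f hf
  refine ⟨ae_restrict_of_ae (MultiRL.ae_integrableOn_rlIntegral hα hf), ?_⟩
  exact (MultiRL.aeEq_rlKernel_iff (hK α hα) hα).1
    (MultiRL.aeEq_rlKernel_of_index_law hn hK ha (fun j => (haK j).1) (fun j => (haK j).2)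
      hidx hc hα) f hf
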